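/- Let $G$ be a uniformly random $4$-regular simple graph on the vertex set $\{1,\dots,n\}$, and let $S^p$ be a random set of seeds, which contains every vertex independently with probability $p$ (independently of $G$), where $p=p(n)\in[0,1]$ may depend on $n$. Consider the coloring process $S_0,S_1,\dots$ under simple majority: $S_0=S^p$ (black vertices), and $S_{i+1}$ is obtained from $S_i$ by adding all vertices that have at least two of their four neighbours in $S_i$ (black vertices stay black). A set of seeds is called a dynamo if $S_i$ is the whole vertex set for some $i$. If $p(n)\le 0.10$ for all $n$, then with high probability $S^p$ is not a dynamo on $G$; that is, $\mathbb{P}(S^p\text{ is a dynamo on }G)\to 0$ as $n\to\infty$. Moreover, with high probability fewer than $40\%$ of all vertices turn black, that is, $\mathbb{P}\bigl(|\bigcup_i S_i| < 0.40\,n\bigr)\to 1$. -/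

import Mathlib

open Filter Topology

namespace Dynamo

open Classical in
/-- The coloring process `S₀, S₁, …` induced on the graph `G` by the set of seeds `S` with
thresholds `ψ`: `S₀ = S`, and `S_{i+1}` is obtained from `S_i` by adding every white vertex `v`
(that is, `v ∉ S_i`) which has at least `ψ v` neighbours in `S_i`. -/
noncomputable def coloringProcess {V : Type*} [Fintype V] (G : SimpleGraph V) (ψ : V → ℕ)
    (S : Finset V) : ℕ → Finset V
  | 0 => S
  | i + 1 => coloringProcess G ψ S i ∪
      Finset.univ.filter (fun v => v ∉ coloringProcess G ψ S i ∧
        ψ v ≤ (Finset.univ.filter (fun w => G.Adj v w ∧ w ∈ coloringProcess G ψ S i)).card)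

/-- `S` is a dynamic monopoly (dynamo) if at some step of the process all vertices are black. -/
def IsDynamo {V : Type*} [Fintype V] (G : SimpleGraph V) (ψ : V → ℕ) (S : Finset V) : Prop :=
  ∃ i, coloringProcess G ψ S i = Finset.univ

open Classical in
/-- The set of all vertices that are turned black at some time (the seeds, at time `0`,
included). -/
noncomputable def turnedBlack {V : Type*} [Fintype V] (G : SimpleGraph V) (ψ : V → ℕ)
    (S : Finset V) : Finset V :=
  Finset.univ.filter (fun v => ∃ i, v ∈ coloringProcess G ψ S i)

/-- The simple majority threshold on a `4`-regular graph: half of the four neighbours. -/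
def simpleMajority {V : Type*} : V → ℕ := fun _ => 2

open Classical in
/-- All `d`-regular simple graphs on `n` labelled vertices. -/
noncomputable def regularGraphs (n d : ℕ) : Finset (SimpleGraph (Fin n)) :=
  Finset.univ.filter (fun G => G.IsRegularOfDegree d)

open Classical in
/-- The probability that the random set of seeds `S^p`, which contains every vertex
independently with probability `p`, equals `S`. -/
noncomputable def seedProb {V : Type*} [Fintype V] (p : ℝ) (S : Finset V) : ℝ :=
  ∏ v, if v ∈ S then p else 1 - p

open Classical in
/-- The probability of the event `E G S^p`, where `G` is a uniformly random `d`-regular graph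
on `n` labelled vertices and `S^p` is a random set of seeds independent of `G`. -/
noncomputable def prob (n d : ℕ) (p : ℝ)
    (E : SimpleGraph (Fin n) → Finset (Fin n) → Prop) : ℝ :=
  (∑ G ∈ regularGraphs n d, ∑ S : Finset (Fin n), if E G S then seedProb p S else 0) /
    ((regularGraphs n d).card : ℝ)

end Dynamo

namespace Dynamo

/-! Work in the configuration model: every vertex has four points, and a perfect matching of all
points gives a 4-regular multigraph. If every vertex of a set `U` of nonseeds sends at most one edge
out of `U`, then no vertex of `U` ever sees two black neighbours, so `U` stays white. It suffices to
find such a white core with at least `t / 4` vertices, where `t ≈ 2.56 n`; then at most `0.36 n`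
vertices turn black.

Fix the seeds and expose the matching edge by edge, always at a free point of a seed or of a vertex
with at most two free points. When no such point is left, the vertices that still have free points
form a white core. If this has not happened by the time `t` points are free, then fewer than `t`
points lie on nonseeds with three or four free points. `totalWeight` is the conditional expectation
of that last number at size `t`: a martingale with bounded steps. With `s = √(t / 4n)` its initial
value is about `(1 - p) n (12 s³ - 8 s⁴)`. It must exceed `t = 4 s² n`, that is, `(1 - p)(12 s - 8
s²) > 4`; at `s = 0.8` and `p = 0.1` the left side is `4.032`. Chebyshev's inequality then gives
failure probability `O(1/n)` (`card_not_hasWhiteCore_le`).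

Switchings show that a constant fraction of all matchings is simple (`card_matchingsOn_le_simple`),
and every 4-regular graph arises from the same number `24 ^ n` of simple matchings
(`card_fiber_pointGraph`), so the bound passes to random regular graphs at the cost of a constant. A
second use of Chebyshev's inequality controls the number of seeds. -/

/-- The involutions of `α` that move exactly the elements of `X`, that is, the perfect matchings
of `X`. -/
def matchingsOn {α : Type*} [Fintype α] [DecidableEq α] (X : Finset α) :
    Finset (Equiv.Perm α) :=
  Finset.univ.filter (fun m => (∀ x, m (m x) = x) ∧ ∀ x, m x ≠ x ↔ x ∈ X)

/-! ### Perfect matchings and the exposure of one edge -/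

section Matchings

variable {α : Type*} [Fintype α] [DecidableEq α]

lemma mem_matchingsOn {X : Finset α} {m : Equiv.Perm α} :
    m ∈ matchingsOn X ↔ (∀ x, m (m x) = x) ∧ ∀ x, m x ≠ x ↔ x ∈ X := by
  simp [matchingsOn]

lemma apply_mem_of_mem_matchingsOn {X : Finset α} {m : Equiv.Perm α} (hm : m ∈ matchingsOn X)
    {x : α} (hx : x ∈ X) : m x ∈ X := by
  rw [mem_matchingsOn] at hm
  rw [← hm.2, hm.1]
  exact ((hm.2 x).2 hx).symm

lemma swap_mul_mem_matchingsOn {X : Finset α} {b y : α} (hb : b ∈ X) (hy : y ∈ X.erase b)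
    {m : Equiv.Perm α} (hm : m ∈ matchingsOn ((X.erase b).erase y)) :
    Equiv.swap b y * m ∈ matchingsOn X := by
  rw [mem_matchingsOn] at hm ⊢
  obtain ⟨h1, h2⟩ := hm
  have hyb : y ≠ b := (Finset.mem_erase.1 hy).1
  have hyX : y ∈ X := (Finset.mem_erase.1 hy).2
  have mb : m b = b := by
    by_contra h; have := (h2 b).1 h; simp at this
  have my : m y = y := by
    by_contra h; have := (h2 y).1 h; simp at this
  have key : ∀ x, x ≠ b → x ≠ y → (Equiv.swap b y) (m x) = m x := by
    intro x hxb hxy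
    refine Equiv.swap_apply_of_ne_of_ne ?_ ?_
    · intro h; apply hxb; rw [← h1 x, h, mb]
    · intro h; apply hxy; rw [← h1 x, h, my]
  constructor
  · intro x
    by_cases hxb : x = b
    · subst hxb; simp [mb, my]
    by_cases hxy : x = y
    · subst hxy; simp [mb, my]
    simp only [Equiv.Perm.mul_apply]
    rw [key x hxb hxy, h1, Equiv.swap_apply_of_ne_of_ne hxb hxy]
  · intro x
    by_cases hxb : x = b
    · subst hxb; simp [mb, hb, hyb]
    by_cases hxy : x = y
    · subst hxy; simp [my, hyX, hyb.symm]
    simp only [Equiv.Perm.mul_apply]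
    rw [key x hxb hxy, h2]
    simp [hxb, hxy]

lemma swap_mul_mem_matchingsOn_erase {X : Finset α} {b : α} {m : Equiv.Perm α}
    (hm : m ∈ matchingsOn X) :
    Equiv.swap b (m b) * m ∈ matchingsOn ((X.erase b).erase (m b)) := by
  rw [mem_matchingsOn] at hm ⊢
  obtain ⟨h1, h2⟩ := hm
  have key : ∀ x, x ≠ b → x ≠ m b → (Equiv.swap b (m b)) (m x) = m x := by
    intro x hxb hxy
    refine Equiv.swap_apply_of_ne_of_ne ?_ ?_
    · intro h; apply hxy; rw [← h, h1]
    · intro h; exact hxb (m.injective h)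
  constructor
  · intro x
    by_cases hxb : x = b
    · subst hxb; simp
    by_cases hxy : x = m b
    · subst hxy; simp [h1]
    simp only [Equiv.Perm.mul_apply]
    rw [key x hxb hxy, h1, Equiv.swap_apply_of_ne_of_ne hxb hxy]
  · intro x
    by_cases hxb : x = b
    · subst hxb; simp
    by_cases hxy : x = m b
    · subst hxy; simp [h1]
    simp only [Equiv.Perm.mul_apply]
    rw [key x hxb hxy, h2]
    simp [hxb, hxy]

/-- This is the principle of deferred decisions in counting form: the partner `y` of `b` is revealed
first, and the rest is an arbitrary matching of the remaining points. -/
lemma sum_matchingsOn {M : Type*} [AddCommMonoid M] {X : Finset α} {b : α} (hb : b ∈ X)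
    (f : Equiv.Perm α → M) :
    ∑ m ∈ matchingsOn X, f m =
      ∑ y ∈ X.erase b, ∑ m ∈ matchingsOn ((X.erase b).erase y), f (Equiv.swap b y * m) := by
  rw [Finset.sum_sigma']
  refine Finset.sum_bij' (fun m _ => ⟨m b, Equiv.swap b (m b) * m⟩)
    (fun a _ => Equiv.swap b a.1 * a.2) ?_ ?_ ?_ ?_ ?_
  · intro m hm
    rw [Finset.mem_sigma]
    refine ⟨Finset.mem_erase.2 ⟨((mem_matchingsOn.1 hm).2 b).2 hb,
      apply_mem_of_mem_matchingsOn hm hb⟩, swap_mul_mem_matchingsOn_erase hm⟩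
  · rintro ⟨y, m⟩ h
    rw [Finset.mem_sigma] at h
    exact swap_mul_mem_matchingsOn hb h.1 h.2
  · intro m hm
    simp
  · rintro ⟨y, m⟩ h
    rw [Finset.mem_sigma] at h
    have mb : m b = b := by
      by_contra hh; have := ((mem_matchingsOn.1 h.2).2 b).1 hh; simp at this
    simp [mb]
  · intro m hm
    simp

lemma card_matchingsOn (k : ℕ) : ∀ X : Finset α, X.card = 2 * k →
    (matchingsOn X).card = ∏ i ∈ Finset.range k, (2 * i + 1) := by
  induction k with
  | zero =>
    intro X hX
    have : X = ∅ := by simpa using hX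
    subst this
    rw [Finset.prod_range_zero, Finset.card_eq_one]
    refine ⟨1, ?_⟩
    ext m
    rw [mem_matchingsOn, Finset.mem_singleton]
    constructor
    · intro h
      ext x
      simpa using h.2 x
    · rintro rfl
      simp
  | succ k ih =>
    intro X hX
    obtain ⟨b, hb⟩ : X.Nonempty := by
      rw [← Finset.card_pos]; omega
    have h1 : (X.erase b).card = 2 * k + 1 := by rw [Finset.card_erase_of_mem hb]; omega
    rw [Finset.card_eq_sum_ones, sum_matchingsOn hb, Finset.prod_range_succ]
    have : ∀ y ∈ X.erase b, ∑ m ∈ matchingsOn ((X.erase b).erase y), 1 =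
        ∏ i ∈ Finset.range k, (2 * i + 1) := by
      intro y hy
      rw [← Finset.card_eq_sum_ones]
      exact ih _ (by rw [Finset.card_erase_of_mem hy]; omega)
    rw [Finset.sum_congr rfl this, Finset.sum_const, h1, smul_eq_mul, mul_comm]

end Matchings

/-! ### White cores and the exposure martingale -/

/-- The number of points of the vertex `v` in a set `X` of points, where every vertex has four
points. -/
def freeDegree {V : Type*} [DecidableEq V] (X : Finset (V × Fin 4)) (v : V) : ℕ :=
  (Finset.univ.filter (fun i : Fin 4 => (v, i) ∈ X)).card

/-- There is a set `U` of at least `t / 4` vertices outside `S` such that every vertex of `U` has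
at most one point that is outside `X` or matched by `m` to a point of a vertex outside `U`. -/
def HasWhiteCore {V : Type*} [DecidableEq V] (t : ℕ) (S : Finset V)
    (X : Finset (V × Fin 4)) (m : Equiv.Perm (V × Fin 4)) : Prop :=
  ∃ U : Finset V, Disjoint U S ∧ t ≤ 4 * U.card ∧
    ∀ v ∈ U, (Finset.univ.filter (fun i : Fin 4 => (v, i) ∉ X ∨ (m (v, i)).1 ∉ U)).card ≤ 1

/-- The weight of a vertex with `k` free points. -/
noncomputable def vertexWeight (β γ : ℝ) (k : ℕ) : ℝ :=
  if k = 4 then 12 * γ - 8 * β else if k = 3 then 3 * γ else 0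

/-- The change of `vertexWeight` when a vertex with `k` free points loses one. -/
noncomputable def vertexDrop (β γ : ℝ) (k : ℕ) : ℝ :=
  if k = 4 then 9 * γ - 8 * β else if k = 3 then 3 * γ else 0

/-- The total weight of the vertices outside the seed set `S`. -/
noncomputable def totalWeight {V : Type*} [Fintype V] [DecidableEq V] (β γ : ℝ) (S : Finset V)
    (X : Finset (V × Fin 4)) : ℝ :=
  ∑ v ∈ Finset.univ.filter (fun v => v ∉ S), vertexWeight β γ (freeDegree X v)

/-- The discount factor `∏ (1 - s / (t + 2 i + 1))` over `i < j`. -/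
noncomputable def discount (s : ℝ) (t j : ℕ) : ℝ :=
  ∏ i ∈ Finset.range j, (1 - s / ((t : ℝ) + 2 * i + 1))

section Exposure

variable {V : Type*} [DecidableEq V]

lemma freeDegree_le (X : Finset (V × Fin 4)) (v : V) : freeDegree X v ≤ 4 := by
  unfold freeDegree
  exact (Finset.card_filter_le _ _).trans (by simp)

lemma card_not_mem_add_freeDegree (X : Finset (V × Fin 4)) (v : V) :
    (Finset.univ.filter (fun i : Fin 4 => (v, i) ∉ X)).card + freeDegree X v = 4 := by
  unfold freeDegree
  have := Finset.card_filter_add_card_filter_not (s := (Finset.univ : Finset (Fin 4)))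
    (fun i : Fin 4 => (v, i) ∈ X)
  simp only [Finset.card_univ, Fintype.card_fin] at this
  omega

lemma freeDegree_erase_of_ne {X : Finset (V × Fin 4)} {x : V × Fin 4} {v : V} (h : x.1 ≠ v) :
    freeDegree (X.erase x) v = freeDegree X v := by
  unfold freeDegree
  congr 1
  ext i
  have : (v, i) ≠ x := by rintro rfl; exact h rfl
  simp [this]

lemma freeDegree_erase_add_one {X : Finset (V × Fin 4)} {x : V × Fin 4} (h : x ∈ X) :
    freeDegree (X.erase x) x.1 + 1 = freeDegree X x.1 := by
  unfold freeDegree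
  have : (Finset.univ.filter (fun i : Fin 4 => (x.1, i) ∈ X.erase x)) =
      (Finset.univ.filter (fun i : Fin 4 => (x.1, i) ∈ X)).erase x.2 := by
    ext i
    simp [Finset.mem_erase, Prod.ext_iff]
  rw [this, Finset.card_erase_add_one]
  simpa using h

variable [Fintype V]

lemma sum_points_eq (X : Finset (V × Fin 4)) (g : V → ℝ) :
    ∑ y ∈ X, g y.1 = ∑ v, (freeDegree X v : ℝ) * g v := by
  have : X = Finset.univ.filter (fun y => y ∈ X) := by simp
  conv_lhs => rw [this]
  rw [Finset.sum_filter, Fintype.sum_prod_type]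
  refine Finset.sum_congr rfl fun v _ => ?_
  exact (Finset.sum_filter (fun i : Fin 4 => (v, i) ∈ X) (fun _ => g v)).symm.trans
    (by rw [Finset.sum_const, nsmul_eq_mul]; rfl)

/-- The stopping configuration. All free points belong to the core, hence so do their partners, and
a core vertex has lost at most one point. The core is large since it carries all of `X` with four
points per vertex. -/
lemma hasWhiteCore_of_forall_mem {t : ℕ} {S : Finset V} {X : Finset (V × Fin 4)}
    {m : Equiv.Perm (V × Fin 4)} (ht : t ≤ X.card) (hm : m ∈ matchingsOn X)
    (h : ∀ x ∈ X, x.1 ∉ S ∧ 3 ≤ freeDegree X x.1) : HasWhiteCore t S X m := by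
  refine ⟨Finset.univ.filter (fun v => v ∉ S ∧ 3 ≤ freeDegree X v), ?_, ?_, ?_⟩
  · rw [Finset.disjoint_left]
    intro v hv
    exact (Finset.mem_filter.1 hv).2.1
  · refine ht.trans ?_
    have hsub : X ⊆ (Finset.univ.filter (fun v => v ∉ S ∧ 3 ≤ freeDegree X v)) ×ˢ
        (Finset.univ : Finset (Fin 4)) := by
      intro x hx
      simpa using h x hx
    have := Finset.card_le_card hsub
    rw [Finset.card_product] at this
    simp only [Finset.card_univ, Fintype.card_fin] at this
    omega
  · intro v hv
    have hv' := (Finset.mem_filter.1 hv).2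
    have : (Finset.univ.filter (fun i : Fin 4 => (v, i) ∉ X ∨ (m (v, i)).1 ∉
        Finset.univ.filter (fun v => v ∉ S ∧ 3 ≤ freeDegree X v))) =
        Finset.univ.filter (fun i : Fin 4 => (v, i) ∉ X) := by
      ext i
      simp only [Finset.mem_filter, Finset.mem_univ, true_and]
      constructor
      · rintro (h1 | h1)
        · exact h1
        · intro h2
          exact h1 (h _ (apply_mem_of_mem_matchingsOn hm h2))
      · exact Or.inl
    rw [this]
    have := card_not_mem_add_freeDegree X v
    omega

/-- The same `U` works: points already exposed are counted as leaving `U`, so putting an exposed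
edge back can only help. -/
lemma hasWhiteCore_swap_mul {t : ℕ} {S : Finset V} {X : Finset (V × Fin 4)} {b y : V × Fin 4}
    {m : Equiv.Perm (V × Fin 4)} (hm : m ∈ matchingsOn ((X.erase b).erase y))
    (h : HasWhiteCore t S ((X.erase b).erase y) m) :
    HasWhiteCore t S X (Equiv.swap b y * m) := by
  obtain ⟨U, hU, ht, hc⟩ := h
  refine ⟨U, hU, ht, fun v hv => (Finset.card_le_card ?_).trans (hc v hv)⟩
  intro i
  simp only [Finset.mem_filter, Finset.mem_univ, true_and]
  rintro (h1 | h1)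
  · left
    exact fun h2 => h1 (Finset.mem_of_mem_erase (Finset.mem_of_mem_erase h2))
  · by_cases h2 : (v, i) ∈ (X.erase b).erase y
    · right
      have h3 := apply_mem_of_mem_matchingsOn hm h2
      rw [Finset.mem_erase, Finset.mem_erase] at h3
      rw [Equiv.Perm.mul_apply, Equiv.swap_apply_of_ne_of_ne h3.2.1 h3.1] at h1
      exact h1
    · exact Or.inl h2

/-- The vertex of `b` has weight zero before and after, so only the vertex of `y` contributes to the
change. -/
lemma totalWeight_erase_erase (β γ : ℝ) {S : Finset V} {X : Finset (V × Fin 4)}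
    {b y : V × Fin 4} (hbw : b.1 ∈ S ∨ freeDegree X b.1 ≤ 2) (hy : y ∈ X.erase b) :
    totalWeight β γ S ((X.erase b).erase y) = totalWeight β γ S X -
      (if y.1 ∈ S then 0 else vertexDrop β γ (freeDegree X y.1)) := by
  have hpt : ∀ v ∈ Finset.univ.filter (fun v => v ∉ S),
      vertexWeight β γ (freeDegree ((X.erase b).erase y) v) = vertexWeight β γ (freeDegree X v) -
        (if v = y.1 then vertexDrop β γ (freeDegree X v) else 0) := by
    intro v hv
    have hvS : v ∉ S := (Finset.mem_filter.1 hv).2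
    by_cases hbv : b.1 = v
    · have h2 : freeDegree X v ≤ 2 := by
        rcases hbw with h | h
        · exact absurd (hbv ▸ h) hvS
        · exact hbv ▸ h
      have h3 : freeDegree ((X.erase b).erase y) v ≤ freeDegree X v := by
        unfold freeDegree
        apply Finset.card_le_card
        intro i
        simp only [Finset.mem_filter, Finset.mem_univ, true_and]
        exact fun h => Finset.mem_of_mem_erase (Finset.mem_of_mem_erase h)
      have e1 : ∀ k, k ≤ 2 → vertexWeight β γ k = 0 := by
        intro k hk; unfold vertexWeight; rw [if_neg (by omega), if_neg (by omega)]
      have e2 : ∀ k, k ≤ 2 → vertexDrop β γ k = 0 := by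
        intro k hk; unfold vertexDrop; rw [if_neg (by omega), if_neg (by omega)]
      rw [e1 _ h2, e1 _ (h3.trans h2), e2 _ h2]
      simp
    · by_cases hyv : y.1 = v
      · subst hyv
        have h1 := freeDegree_erase_add_one hy
        rw [freeDegree_erase_of_ne hbv] at h1
        have h4 := freeDegree_le X y.1
        rw [if_pos rfl, ← h1]
        generalize freeDegree ((X.erase b).erase y) y.1 = k at *
        have : k ≤ 3 := by omega
        unfold vertexWeight vertexDrop
        interval_cases k <;> norm_num
        ring
      · rw [freeDegree_erase_of_ne hyv, freeDegree_erase_of_ne hbv, if_neg (Ne.symm hyv), sub_zero]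
  unfold totalWeight
  rw [Finset.sum_congr rfl hpt, Finset.sum_sub_distrib, Finset.sum_ite_eq']
  simp only [Finset.mem_filter, Finset.mem_univ, true_and]
  split_ifs <;> simp_all

/-- The martingale property. A uniform partner among `L` points hits a vertex with `k` free points
with probability `k / L`; the coefficients in `vertexWeight` solve the resulting linear recursion,
with values `4` and `3` at `β = γ = 1`. -/
lemma sum_vertexDrop {β γ β' γ' L : ℝ} (hL : L ≠ 0) (hβ : β' = β * (1 - 4 / L))
    (hγ : γ' = γ * (1 - 3 / L)) {S : Finset V} {X : Finset (V × Fin 4)}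
    {b : V × Fin 4} (hb : b ∈ X) (hbw : b.1 ∈ S ∨ freeDegree X b.1 ≤ 2) :
    ∑ y ∈ X.erase b, (if y.1 ∈ S then 0 else vertexDrop β γ (freeDegree X y.1)) =
      L * (totalWeight β γ S X - totalWeight β' γ' S X) := by
  have hb0 : (if b.1 ∈ S then 0 else vertexDrop β γ (freeDegree X b.1)) = 0 := by
    rcases hbw with h | h
    · rw [if_pos h]
    · have : vertexDrop β γ (freeDegree X b.1) = 0 := by
        unfold vertexDrop; rw [if_neg (by omega), if_neg (by omega)]
      rw [this, ite_self]
  have h1 := Finset.add_sum_erase X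
    (fun y => if y.1 ∈ S then 0 else vertexDrop β γ (freeDegree X y.1)) hb
  simp only [hb0, zero_add] at h1
  rw [h1, sum_points_eq X (fun v => if v ∈ S then 0 else vertexDrop β γ (freeDegree X v))]
  unfold totalWeight
  rw [← Finset.sum_sub_distrib, Finset.mul_sum, Finset.sum_filter]
  refine Finset.sum_congr rfl fun v _ => ?_
  by_cases hv : v ∈ S
  · simp [hv]
  · rw [if_neg hv, if_pos hv]
    have h4 := freeDegree_le X v
    generalize freeDegree X v = k at *
    subst hβ hγ
    unfold vertexWeight vertexDrop
    interval_cases k <;> norm_num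
    · field_simp; ring
    · field_simp; ring

lemma sq_vertexDrop_le {β γ : ℝ} (hβ0 : 0 ≤ β) (hβ1 : β ≤ 1) (hγ0 : 0 ≤ γ) (hγ1 : γ ≤ 1)
    (k : ℕ) : (vertexDrop β γ k) ^ 2 ≤ 81 := by
  unfold vertexDrop
  split_ifs
  · nlinarith
  · nlinarith
  · norm_num

lemma discount_succ (s : ℝ) (t j : ℕ) :
    discount s t (j + 1) = discount s t j * (1 - s / ((t : ℝ) + 2 * j + 1)) := by
  simp [discount, Finset.prod_range_succ]

lemma discount_nonneg_le_one {s : ℝ} {t : ℕ} (hs0 : 0 ≤ s) (hs : s ≤ t) (j : ℕ) :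
    0 ≤ discount s t j ∧ discount s t j ≤ 1 := by
  have h : ∀ i : ℕ, 0 ≤ 1 - s / ((t : ℝ) + 2 * i + 1) ∧ 1 - s / ((t : ℝ) + 2 * i + 1) ≤ 1 := by
    intro i
    have hi : (0 : ℝ) ≤ i := by positivity
    have hp : 0 < (t : ℝ) + 2 * i + 1 := by positivity
    have h1 : s / ((t : ℝ) + 2 * i + 1) ≤ 1 := by rw [div_le_one hp]; linarith
    have h2 : 0 ≤ s / ((t : ℝ) + 2 * i + 1) := by positivity
    constructor <;> linarith
  exact ⟨Finset.prod_nonneg fun i _ => (h i).1,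
    Finset.prod_le_one (fun i _ => (h i).1) fun i _ => (h i).2⟩

/-- With `β = γ = 1` the weight counts the free points of nonseeds that have at least three of them,
and the offending point is not counted. -/
lemma totalWeight_one_one_lt_card {S : Finset V} {X : Finset (V × Fin 4)}
    (h : ¬ ∀ x ∈ X, x.1 ∉ S ∧ 3 ≤ freeDegree X x.1) : totalWeight 1 1 S X < X.card := by
  have hX : (X.card : ℝ) = ∑ v, (freeDegree X v : ℝ) := by
    have := sum_points_eq X (fun _ => 1)
    simpa using this
  rw [hX]
  unfold totalWeight
  rw [Finset.sum_filter]
  push Not at h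
  obtain ⟨x, hx, hxw⟩ := h
  have hpos := freeDegree_erase_add_one hx
  refine Finset.sum_lt_sum (fun v _ => ?_) ⟨x.1, Finset.mem_univ _, ?_⟩
  · have h4 := freeDegree_le X v
    generalize freeDegree X v = k at *
    by_cases hv : v ∈ S
    · simp [hv]
    · rw [if_pos hv]
      unfold vertexWeight
      interval_cases k <;> norm_num
  · have hp : (0 : ℝ) < freeDegree X x.1 := by
      rw [← hpos]; positivity
    by_cases hS : x.1 ∈ S
    · simpa [hS] using hp
    · have h3 := hxw hS
      rw [if_pos hS]
      unfold vertexWeight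
      rw [if_neg (by omega), if_neg (by omega)]
      exact hp

open Classical in
/-- Few matchings of `X` have no large white core: the partners of the free points of non-white
vertices are exposed one by one, and the total weight is a martingale. -/
lemma card_not_hasWhiteCore_le {t r : ℕ} (htr : t = 2 * r) (ht : 4 ≤ t) (S : Finset V) {c δ : ℝ}
    (hδ : 0 < δ) (hc : t + δ ≤ c) (j : ℕ) : ∀ X : Finset (V × Fin 4), X.card = t + 2 * j →
    (((matchingsOn X).filter (fun m => ¬ HasWhiteCore t S X m)).card : ℝ) ≤
      (∏ i ∈ Finset.range (r + j), (2 * i + 1) : ℕ) *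
      (((totalWeight (discount 4 t j) (discount 3 t j) S X - c) ^ 2 + 81 * j) / δ ^ 2) := by
  have ht' : (4 : ℝ) ≤ t := by exact_mod_cast ht
  have hwhite : ∀ X : Finset (V × Fin 4), t ≤ X.card →
      (∀ x ∈ X, x.1 ∉ S ∧ 3 ≤ freeDegree X x.1) →
      ((matchingsOn X).filter (fun m => ¬ HasWhiteCore t S X m)).card = 0 := by
    intro X hX h
    rw [Finset.card_eq_zero, Finset.filter_eq_empty_iff]
    intro m hm
    rw [not_not]
    exact hasWhiteCore_of_forall_mem hX hm h
  induction j with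
  | zero =>
    intro X hX
    by_cases h : ∀ x ∈ X, x.1 ∉ S ∧ 3 ≤ freeDegree X x.1
    · rw [hwhite X (by omega) h]
      push_cast
      positivity
    · have h1 := totalWeight_one_one_lt_card h
      have hd : ∀ s, discount s t 0 = 1 := by intro s; simp [discount]
      rw [hd, hd]
      have hXt : (X.card : ℝ) = t := by exact_mod_cast hX
      rw [hXt] at h1
      -- An unfinished exposure has final weight below `t ≤ c - δ`, so the claimed bound is no
      -- better than the trivial one.
      have h2 : 1 ≤ ((totalWeight 1 1 S X - c) ^ 2 + 81 * ((0 : ℕ) : ℝ)) / δ ^ 2 := by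
        rw [le_div_iff₀ (by positivity)]
        push_cast
        nlinarith
      calc _ ≤ ((matchingsOn X).card : ℝ) := by
            exact_mod_cast Finset.card_filter_le _ _
        _ = (∏ i ∈ Finset.range (r + 0), (2 * i + 1) : ℕ) := by
            rw [card_matchingsOn (r + 0) X (by omega)]
        _ ≤ _ := le_mul_of_one_le_right (by positivity) h2
  | succ j ih =>
    intro X hX
    by_cases h : ∀ x ∈ X, x.1 ∉ S ∧ 3 ≤ freeDegree X x.1
    · rw [hwhite X (by omega) h]
      push_cast
      positivity
    push Not at h
    obtain ⟨b, hb, hbw'⟩ := h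
    have hbw : b.1 ∈ S ∨ freeDegree X b.1 ≤ 2 := by
      by_cases hS : b.1 ∈ S
      · exact Or.inl hS
      · right; have := hbw' hS; omega
    set β := discount 4 t j with hβ
    set γ := discount 3 t j with hγ
    set L : ℝ := (t : ℝ) + 2 * j + 1 with hLdef
    have hL : 0 < L := by positivity
    set D : V × Fin 4 → ℝ :=
      fun y => if y.1 ∈ S then 0 else vertexDrop β γ (freeDegree X y.1) with hD
    have hcardb : (X.erase b).card = t + 2 * j + 1 := by
      rw [Finset.card_erase_of_mem hb]; omega
    set P : ℝ := ((∏ i ∈ Finset.range (r + j), (2 * i + 1) : ℕ) : ℝ) with hP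
    have hP0 : 0 ≤ P := by positivity
    have hstep : (((matchingsOn X).filter (fun m => ¬ HasWhiteCore t S X m)).card : ℝ) ≤
        ∑ y ∈ X.erase b, P * (((totalWeight β γ S X - D y - c) ^ 2 + 81 * j) / δ ^ 2) := by
      rw [Finset.card_filter, sum_matchingsOn hb]
      push_cast
      refine Finset.sum_le_sum fun y hy => ?_
      have hXy : ((X.erase b).erase y).card = t + 2 * j := by
        rw [Finset.card_erase_of_mem hy]; omega
      have := ih _ hXy
      rw [totalWeight_erase_erase β γ hbw hy] at this
      refine le_trans ?_ this
      rw [Finset.card_filter]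
      push_cast
      refine Finset.sum_le_sum fun m hm => ?_
      by_cases hg : HasWhiteCore t S ((X.erase b).erase y) m
      · simp [hg, hasWhiteCore_swap_mul hm hg]
      · rw [if_pos hg]
        split_ifs <;> norm_num
    refine hstep.trans ?_
    have hsumD : ∑ y ∈ X.erase b, D y = L * (totalWeight β γ S X -
        totalWeight (discount 4 t (j + 1)) (discount 3 t (j + 1)) S X) :=
      sum_vertexDrop hL.ne' (discount_succ 4 t j) (discount_succ 3 t j) hb hbw
    have hβb := discount_nonneg_le_one (s := 4) (t := t) (by norm_num) ht' j
    have hγb := discount_nonneg_le_one (s := 3) (t := t) (by norm_num) (by linarith) j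
    have hsumD2 : ∑ y ∈ X.erase b, (D y) ^ 2 ≤ L * 81 := by
      have : ∑ y ∈ X.erase b, (D y) ^ 2 ≤ ∑ y ∈ X.erase b, (81 : ℝ) := by
        refine Finset.sum_le_sum fun y _ => ?_
        simp only [hD]
        split_ifs
        · norm_num
        · exact sq_vertexDrop_le hβb.1 hβb.2 hγb.1 hγb.2 _
      rw [Finset.sum_const, hcardb, nsmul_eq_mul] at this
      push_cast at this
      exact this
    set F := totalWeight β γ S X with hF
    set F' := totalWeight (discount 4 t (j + 1)) (discount 3 t (j + 1)) S X with hF'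
    have hprod : ((∏ i ∈ Finset.range (r + (j + 1)), (2 * i + 1) : ℕ) : ℝ) = P * L := by
      rw [← add_assoc, Finset.prod_range_succ]
      push_cast
      rw [hP, hLdef, htr]
      push_cast
      ring
    have hexp : ∑ y ∈ X.erase b, P * (((F - D y - c) ^ 2 + 81 * j) / δ ^ 2) =
        P / δ ^ 2 * (L * ((F - c) ^ 2 + 81 * j) - 2 * (F - c) * ∑ y ∈ X.erase b, D y +
          ∑ y ∈ X.erase b, (D y) ^ 2) := by
      have : ∀ y, P * (((F - D y - c) ^ 2 + 81 * j) / δ ^ 2) =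
          P / δ ^ 2 * (((F - c) ^ 2 + 81 * j) - 2 * (F - c) * D y + (D y) ^ 2) := by
        intro y; ring
      simp only [this]
      rw [← Finset.mul_sum, Finset.sum_add_distrib, Finset.sum_sub_distrib, ← Finset.mul_sum,
        Finset.sum_const, hcardb, nsmul_eq_mul]
      push_cast
      rfl
    rw [hexp, hprod, hsumD]
    push_cast
    -- The mean of `D` is `F - F'`, and `(F - c)² - 2 (F - c)(F - F') = (F' - c)² - (F - F')²`. The
    -- last square is dropped, and each step adds at most `81` to the variance.
    have : L * ((F - c) ^ 2 + 81 * j) - 2 * (F - c) * (L * (F - F')) +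
        ∑ y ∈ X.erase b, (D y) ^ 2 ≤ L * ((F' - c) ^ 2 + 81 * (j + 1)) := by
      nlinarith [mul_nonneg hL.le (sq_nonneg (F - F'))]
    calc _ ≤ P / δ ^ 2 * (L * ((F' - c) ^ 2 + 81 * (j + 1))) :=
          mul_le_mul_of_nonneg_left this (by positivity)
      _ = _ := by ring

end Exposure

/-! ### Estimates for the discount factors -/

section Discount

/-- The factors are `(t + 2 i - 3) / (t + 2 i + 1)`, so the product telescopes with a gap of two. -/
lemma discount_four_mul (t j : ℕ) (ht : 4 ≤ t) :
    discount 4 t j * (((t : ℝ) + 2 * j - 1) * ((t : ℝ) + 2 * j - 3)) =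
      ((t : ℝ) - 1) * ((t : ℝ) - 3) := by
  have ht' : (4 : ℝ) ≤ t := by exact_mod_cast ht
  induction j with
  | zero => simp [discount]
  | succ j ih =>
    rw [discount_succ, ← ih]
    have : (t : ℝ) + 2 * j + 1 ≠ 0 := by positivity
    push_cast
    field_simp
    ring

/-- The product behaves like a power `3/2` and does not telescope; its square is compared with a
telescoping cube. -/
lemma le_discount_three_sq_mul (t j : ℕ) (ht : 4 ≤ t) :
    ((t : ℝ) - 2) ^ 3 ≤ discount 3 t j ^ 2 * ((t : ℝ) + 2 * j - 2) ^ 3 := by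
  have ht' : (4 : ℝ) ≤ t := by exact_mod_cast ht
  induction j with
  | zero => simp [discount]
  | succ j ih =>
    refine ih.trans ?_
    rw [discount_succ, mul_pow, mul_assoc]
    refine mul_le_mul_of_nonneg_left ?_ (sq_nonneg _)
    have hj : (0 : ℝ) ≤ j := by positivity
    have hp : (0 : ℝ) < (t : ℝ) + 2 * j + 1 := by positivity
    push_cast
    have e : 1 - 3 / ((t : ℝ) + 2 * j + 1) = ((t : ℝ) + 2 * j - 2) / ((t : ℝ) + 2 * j + 1) := by
      field_simp; ring
    rw [e, div_pow, div_mul_eq_mul_div, le_div_iff₀ (by positivity)]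
    set u : ℝ := (t : ℝ) + 2 * j with hu
    have hu4 : 4 ≤ u := by linarith
    have e2 : (t : ℝ) + 2 * (j + 1) - 2 = u := by rw [hu]; ring
    rw [e2]
    have : (u - 2) * (u + 1) ^ 2 ≤ u ^ 3 := by nlinarith
    nlinarith [mul_le_mul_of_nonneg_left this (sq_nonneg (u - 2))]

/-- The initial weight of a nonseed vertex after the exposure of a fixed fraction of all edges. -/
lemma le_initial_weight {n t j : ℕ} (hn : 4000 ≤ n) (htj : t + 2 * j = 4 * n)
    (ht1 : 2.56 * (n : ℝ) ≤ t) (ht2 : (t : ℝ) ≤ 2.56 * n + 2) :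
    2.859 ≤ 12 * discount 3 t j - 8 * discount 4 t j := by
  have hn' : (4000 : ℝ) ≤ n := by exact_mod_cast hn
  have ht4 : 4 ≤ t := by
    have : (4 : ℝ) ≤ t := by linarith
    exact_mod_cast this
  have htj' : (t : ℝ) + 2 * j = 4 * n := by exact_mod_cast htj
  have h4 := discount_four_mul t j ht4
  have h3 := le_discount_three_sq_mul t j ht4
  rw [htj'] at h3 h4
  have hγ := (discount_nonneg_le_one (s := 3) (t := t) (by norm_num) (by linarith) j).1
  set β := discount 4 t j
  set γ := discount 3 t j
  have hβ : β ≤ 0.4103 := by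
    by_contra! hc
    have hpos : 0 < (4 * (n : ℝ) - 1) * (4 * n - 3) := mul_pos (by linarith) (by linarith)
    have a1 : 0.4103 * ((4 * (n : ℝ) - 1) * (4 * n - 3)) < ((t : ℝ) - 1) * (t - 3) := by
      rw [← h4]; exact mul_lt_mul_of_pos_right hc hpos
    have a2 : ((t : ℝ) - 1) * (t - 3) ≤ (2.56 * n + 1) * (2.56 * n - 1) :=
      mul_le_mul (by linarith) (by linarith) (by linarith) (by linarith)
    nlinarith
  have hγ2 : 0.5118 ≤ γ := by
    by_contra! hc
    -- The limiting values are `β = 0.64 ^ 2 = 0.4096` and `γ = 0.8 ^ 3 = 0.512`; `n ≥ 4000` absorbs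
    -- the rounding.
    have b1 : (0.63995 * (4 * (n : ℝ) - 2)) ≤ t - 2 := by linarith
    have b2 : (0.63995 * (4 * (n : ℝ) - 2)) ^ 3 ≤ ((t : ℝ) - 2) ^ 3 :=
      pow_le_pow_left₀ (by linarith) b1 3
    have hpos : 0 < (4 * (n : ℝ) - 2) ^ 3 := pow_pos (by linarith) 3
    have b3 : γ ^ 2 < 0.5118 ^ 2 := pow_lt_pow_left₀ hc hγ (by norm_num)
    have b4 := mul_lt_mul_of_pos_right b3 hpos
    rw [mul_pow] at b2
    nlinarith
  linarith

end Discount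

/-! ### Switchings: a positive fraction of matchings is simple -/

section Switching

variable {V : Type*} [DecidableEq V]

/-- The vertex `u` and its neighbours in the multigraph of `m`. -/
def closedNbhd (m : Equiv.Perm (V × Fin 4)) (u : V) : Finset V :=
  insert u (Finset.univ.image (fun i : Fin 4 => (m (u, i)).1))

lemma card_closedNbhd_le (m : Equiv.Perm (V × Fin 4)) (u : V) : (closedNbhd m u).card ≤ 5 := by
  unfold closedNbhd
  refine (Finset.card_insert_le _ _).trans ?_
  have := Finset.card_image_le (s := (Finset.univ : Finset (Fin 4)))
    (f := fun i : Fin 4 => (m (u, i)).1)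
  simp only [Finset.card_univ, Fintype.card_fin] at this
  omega

lemma self_mem_closedNbhd (m : Equiv.Perm (V × Fin 4)) (u : V) : u ∈ closedNbhd m u :=
  Finset.mem_insert_self _ _

lemma apply_mem_closedNbhd (m : Equiv.Perm (V × Fin 4)) (x : V × Fin 4) :
    (m x).1 ∈ closedNbhd m x.1 :=
  Finset.mem_insert_of_mem (Finset.mem_image.2 ⟨x.2, Finset.mem_univ _, rfl⟩)

variable [Fintype V]

/-- The points of the loops and of the multiple edges of a matching of the points. -/
def badPoints (m : Equiv.Perm (V × Fin 4)) : Finset (V × Fin 4) :=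
  Finset.univ.filter (fun x => (m x).1 = x.1 ∨
    ∃ x', x' ≠ x ∧ x'.1 = x.1 ∧ (m x').1 = (m x).1)

/-- The edge at `y` is at distance at least two from the edge at `x`. -/
def farPoints (m : Equiv.Perm (V × Fin 4)) (x : V × Fin 4) : Finset (V × Fin 4) :=
  Finset.univ.filter (fun y => y.1 ∉ closedNbhd m x.1 ∪ closedNbhd m (m x).1 ∧
    (m y).1 ∉ closedNbhd m x.1 ∪ closedNbhd m (m x).1)

/-- The matching in which the edges at `x` and `y` of `m` are replaced by the edge from `x` to `y`
and the edge between their partners. -/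
def switching (m : Equiv.Perm (V × Fin 4)) (x y : V × Fin 4) : Equiv.Perm (V × Fin 4) :=
  Equiv.swap (m x) y * m * Equiv.swap (m x) y

lemma switching_mem {m : Equiv.Perm (V × Fin 4)} (hm : m ∈ matchingsOn Finset.univ)
    (x y : V × Fin 4) : switching m x y ∈ matchingsOn Finset.univ := by
  rw [mem_matchingsOn] at hm ⊢
  refine ⟨fun w => ?_, fun w => ?_⟩
  · simp [switching, hm.1]
  · simp only [Finset.mem_univ, iff_true, switching, Equiv.Perm.mul_apply]
    intro h
    have h2 := congrArg (Equiv.swap (m x) y) h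
    rw [Equiv.swap_apply_self] at h2
    exact ((hm.2 _).2 (Finset.mem_univ _)) h2

lemma card_fst_mem (T : Finset V) :
    (Finset.univ.filter (fun y : V × Fin 4 => y.1 ∈ T)).card = 4 * T.card := by
  have : Finset.univ.filter (fun y : V × Fin 4 => y.1 ∈ T) = T ×ˢ Finset.univ := by
    ext y; simp
  rw [this, Finset.card_product, Finset.card_univ, Fintype.card_fin, mul_comm]

lemma card_le_card_farPoints (m : Equiv.Perm (V × Fin 4)) (x : V × Fin 4) :
    4 * Fintype.card V ≤ (farPoints m x).card + 80 := by
  set T := closedNbhd m x.1 ∪ closedNbhd m (m x).1 with hT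
  have hTc : T.card ≤ 10 := (Finset.card_union_le _ _).trans
    (by have := card_closedNbhd_le m x.1; have := card_closedNbhd_le m (m x).1; omega)
  have h1 := card_fst_mem T
  have h2 : (Finset.univ.filter (fun y : V × Fin 4 => (m y).1 ∈ T)).card = 4 * T.card := by
    rw [← h1]
    refine Finset.card_bij (fun y _ => m y) ?_ ?_ ?_
    · intro y hy; simpa using hy
    · intro y _ y' _ h; exact m.injective h
    · intro y hy; exact ⟨m.symm y, by simpa using hy, by simp⟩
  have h3 : (Finset.univ : Finset (V × Fin 4)) ⊆ farPoints m x ∪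
      (Finset.univ.filter (fun y : V × Fin 4 => y.1 ∈ T) ∪
        Finset.univ.filter (fun y : V × Fin 4 => (m y).1 ∈ T)) := by
    intro y _
    simp only [farPoints, Finset.mem_union, Finset.mem_filter, Finset.mem_univ, true_and, ← hT]
    tauto
  have h4 := Finset.card_le_card h3
  have h5 := Finset.card_union_le (farPoints m x)
    (Finset.univ.filter (fun y : V × Fin 4 => y.1 ∈ T) ∪
        Finset.univ.filter (fun y : V × Fin 4 => (m y).1 ∈ T))
  have h6 := Finset.card_union_le (Finset.univ.filter (fun y : V × Fin 4 => y.1 ∈ T))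
    (Finset.univ.filter (fun y : V × Fin 4 => (m y).1 ∈ T))
  rw [Finset.card_univ, Fintype.card_prod, Fintype.card_fin] at h4
  omega

lemma mem_farPoints {m : Equiv.Perm (V × Fin 4)} {x y : V × Fin 4} (h : y ∈ farPoints m x) :
    (y.1 ≠ x.1 ∧ y.1 ≠ (m x).1 ∧ (m y).1 ≠ x.1 ∧ (m y).1 ≠ (m x).1) ∧
    ∀ w, (w.1 = x.1 ∨ w.1 = (m x).1) → (m w).1 ≠ y.1 ∧ (m w).1 ≠ (m y).1 := by
  simp only [farPoints, Finset.mem_filter, Finset.mem_univ, true_and, Finset.mem_union,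
    not_or] at h
  obtain ⟨⟨h1, h2⟩, h3, h4⟩ := h
  refine ⟨⟨?_, ?_, ?_, ?_⟩, ?_⟩
  · rintro e; exact h1 (e ▸ self_mem_closedNbhd m _)
  · rintro e; exact h2 (e ▸ self_mem_closedNbhd m _)
  · rintro e; exact h3 (e ▸ self_mem_closedNbhd m _)
  · rintro e; exact h4 (e ▸ self_mem_closedNbhd m _)
  · intro w hw
    have hmem := apply_mem_closedNbhd m w
    rcases hw with hw | hw <;> rw [hw] at hmem
    · exact ⟨fun e => h1 (e ▸ hmem), fun e => h3 (e ▸ hmem)⟩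
    · exact ⟨fun e => h2 (e ▸ hmem), fun e => h4 (e ▸ hmem)⟩

lemma switching_apply {m : Equiv.Perm (V × Fin 4)} (hm : m ∈ matchingsOn Finset.univ)
    {x y : V × Fin 4} (hy : y ∈ farPoints m x) :
    switching m x y x = y ∧ switching m x y y = x ∧ switching m x y (m x) = m y ∧
      switching m x y (m y) = m x ∧
      ∀ w, w ≠ x → w ≠ y → w ≠ m x → w ≠ m y → switching m x y w = m w := by
  rw [mem_matchingsOn] at hm
  obtain ⟨h1, h2⟩ := hm
  have hne : ∀ w, m w ≠ w := fun w => (h2 w).2 (Finset.mem_univ _)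
  obtain ⟨⟨f1, f2, f3, f4⟩, -⟩ := mem_farPoints hy
  have g1 : y ≠ x := fun e => f1 (e ▸ rfl)
  have g2 : y ≠ m x := fun e => f2 (congrArg Prod.fst e)
  have g3 : m y ≠ x := fun e => f3 (congrArg Prod.fst e)
  have g4 : m y ≠ m x := fun e => f4 (congrArg Prod.fst e)
  simp only [switching, Equiv.Perm.mul_apply]
  refine ⟨?_, ?_, ?_, ?_, ?_⟩
  · rw [Equiv.swap_apply_of_ne_of_ne (hne x).symm g1.symm, Equiv.swap_apply_left]
  · rw [Equiv.swap_apply_right, h1, Equiv.swap_apply_of_ne_of_ne (hne x).symm g1.symm]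
  · rw [Equiv.swap_apply_left, Equiv.swap_apply_of_ne_of_ne g4 (hne y)]
  · rw [Equiv.swap_apply_of_ne_of_ne g4 (hne y), h1, Equiv.swap_apply_right]
  · intro w w1 w2 w3 w4
    rw [Equiv.swap_apply_of_ne_of_ne w3 w2, Equiv.swap_apply_of_ne_of_ne]
    · exact fun e => w1 (m.injective e)
    · intro e; apply w4; rw [← e, h1]

lemma mem_badPoints {m : Equiv.Perm (V × Fin 4)} {x : V × Fin 4} : x ∈ badPoints m ↔
    (m x).1 = x.1 ∨ ∃ x', x' ≠ x ∧ x'.1 = x.1 ∧ (m x').1 = (m x).1 := by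
  simp [badPoints]

/-- Since `y` is far from `x`, the two new edges are neither loops nor parallel to any edge; all
other edges are unchanged, so no point becomes bad and `x` is repaired. -/
lemma badPoints_switching_ssubset {m : Equiv.Perm (V × Fin 4)}
    (hm : m ∈ matchingsOn Finset.univ) {x y : V × Fin 4} (hx : x ∈ badPoints m)
    (hy : y ∈ farPoints m x) (hyb : y ∉ badPoints m) :
    badPoints (switching m x y) ⊂ badPoints m := by
  obtain ⟨s1, s2, s3, s4, s5⟩ := switching_apply hm hy
  obtain ⟨⟨f1, f2, f3, f4⟩, f5⟩ := mem_farPoints hy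
  rw [mem_matchingsOn] at hm
  obtain ⟨h1, -⟩ := hm
  have f6 : ∀ w, (w.1 = y.1 ∨ w.1 = (m y).1) → (m w).1 ≠ x.1 ∧ (m w).1 ≠ (m x).1 := by
    intro w hw
    have := f5 (m w)
    rw [h1] at this
    constructor <;> intro e <;> simp [e] at this <;> tauto
  have f7 : (m y).1 ≠ y.1 := fun e => hyb (mem_badPoints.2 (Or.inl e))
  generalize switching m x y = m' at *
  have key : ∀ w, w = x ∨ w = y ∨ w = m x ∨ w = m y → w ∉ badPoints m' := by
    intro w hw hbad
    rcases mem_badPoints.1 hbad with hl | ⟨w', e1, e2, e3⟩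
    · rcases hw with rfl | rfl | rfl | rfl
      · rw [s1] at hl; exact f1 hl
      · rw [s2] at hl; exact f1 hl.symm
      · rw [s3] at hl; exact f4 hl
      · rw [s4] at hl; exact f4 hl.symm
    · by_cases c : w' = x ∨ w' = y ∨ w' = m x ∨ w' = m y
      · rcases c with rfl | rfl | rfl | rfl <;> rcases hw with rfl | rfl | rfl | rfl <;>
          first
          | exact e1 rfl
          | exact f1 e2
          | exact f1 e2.symm
          | exact f2 e2
          | exact f2 e2.symm
          | exact f3 e2
          | exact f3 e2.symm
          | exact f4 e2
          | exact f4 e2.symm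
          | exact f7 e2
          | exact f7 e2.symm
          | (rw [s1, s3] at e3; exact f7 e3.symm)
          | (rw [s3, s1] at e3; exact f7 e3)
      simp only [not_or] at c
      obtain ⟨c1, c2, c3, c4⟩ := c
      rw [s5 w' c1 c2 c3 c4] at e3
      rcases hw with rfl | rfl | rfl | rfl
      · exact (f5 w' (Or.inl e2)).1 (by rw [e3, s1])
      · exact (f6 w' (Or.inl e2)).1 (by rw [e3, s2])
      · exact (f5 w' (Or.inr e2)).2 (by rw [e3, s3])
      · exact (f6 w' (Or.inr e2)).2 (by rw [e3, s4])
  rw [Finset.ssubset_iff_of_subset]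
  · exact ⟨x, hx, key x (Or.inl rfl)⟩
  · intro w hw
    have n : ∀ w ∈ badPoints m', m' w = m w := by
      intro w hw
      exact s5 w (fun e => key w (Or.inl e) hw) (fun e => key w (Or.inr (Or.inl e)) hw)
        (fun e => key w (Or.inr (Or.inr (Or.inl e))) hw)
        (fun e => key w (Or.inr (Or.inr (Or.inr e))) hw)
    have ew := n w hw
    rcases mem_badPoints.1 hw with hl | ⟨w', e1, e2, e3⟩
    · exact mem_badPoints.2 (Or.inl (by rw [← ew, hl]))
    · have hw' : w' ∈ badPoints m' := mem_badPoints.2 (Or.inr ⟨w, e1.symm, e2.symm, e3.symm⟩)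
      exact mem_badPoints.2 (Or.inr ⟨w', e1, e2, by rw [← n w' hw', e3, ew]⟩)

/-- A loop, or the parallel edge that survives, still locates the old partner of `x` after the
switching. This limits the number of ways to reverse it. -/
lemma fst_mem_closedNbhd_switching {m : Equiv.Perm (V × Fin 4)}
    (hm : m ∈ matchingsOn Finset.univ) {x y : V × Fin 4} (hx : x ∈ badPoints m)
    (hy : y ∈ farPoints m x) : (m x).1 ∈ closedNbhd (switching m x y) x.1 := by
  obtain ⟨-, -, -, -, s5⟩ := switching_apply hm hy
  obtain ⟨⟨f1, -, f3, -⟩, -⟩ := mem_farPoints hy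
  rcases mem_badPoints.1 hx with hl | ⟨x', e1, e2, e3⟩
  · rw [hl]; exact self_mem_closedNbhd _ _
  · by_cases c : x' = m x
    · rw [← c, e2]; exact self_mem_closedNbhd _ _
    · have : switching m x y x' = m x' := by
        refine s5 x' e1 ?_ c ?_
        · rintro rfl; exact f1 e2
        · rintro rfl; exact f3 e2
      rw [← e3, ← this, ← e2]
      exact apply_mem_closedNbhd _ _

/-- Double counting: a switching is recovered from its result, `x` and the old partner of `x`. The
latter is one of at most `20` points, four on each of five vertices. -/
lemma sum_card_switchings_le (A B : Finset (Equiv.Perm (V × Fin 4)))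
    (hB : B ⊆ matchingsOn Finset.univ)
    (Y : Equiv.Perm (V × Fin 4) → V × Fin 4 → Finset (V × Fin 4))
    (hY : ∀ m ∈ B, ∀ x ∈ badPoints m, Y m x ⊆ farPoints m x)
    (hA : ∀ m ∈ B, ∀ x ∈ badPoints m, ∀ y ∈ Y m x, switching m x y ∈ A) :
    ∑ m ∈ B, ∑ x ∈ badPoints m, (Y m x).card ≤ A.card * (4 * Fintype.card V * 20) := by
  have h1 : (A.sigma fun m => (Finset.univ : Finset (V × Fin 4)).sigma fun x =>
      Finset.univ.filter (fun z : V × Fin 4 => z.1 ∈ closedNbhd m x.1)).card ≤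
      A.card * (4 * Fintype.card V * 20) := by
    rw [Finset.card_sigma, ← smul_eq_mul]
    refine Finset.sum_le_card_nsmul _ _ _ fun m _ => ?_
    rw [Finset.card_sigma]
    have : 4 * Fintype.card V = (Finset.univ : Finset (V × Fin 4)).card := by
      rw [Finset.card_univ, Fintype.card_prod, Fintype.card_fin, mul_comm]
    rw [this, ← smul_eq_mul]
    refine Finset.sum_le_card_nsmul _ _ _ fun x _ => ?_
    rw [card_fst_mem]
    have := card_closedNbhd_le m x.1
    omega
  refine le_trans ?_ h1
  have h2 : ∑ m ∈ B, ∑ x ∈ badPoints m, (Y m x).card =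
      (B.sigma fun m => (badPoints m).sigma fun x => Y m x).card := by
    rw [Finset.card_sigma]
    exact Finset.sum_congr rfl fun m _ => (Finset.card_sigma _ _).symm
  rw [h2]
  refine Finset.card_le_card_of_injOn
    (fun q => ⟨switching q.1 q.2.1 q.2.2, ⟨q.2.1, q.1 q.2.1⟩⟩) ?_ ?_
  · rintro ⟨m, x, y⟩ hq
    simp only [Finset.coe_sigma, Set.mem_sigma_iff, Finset.mem_coe] at hq
    obtain ⟨hm, hx, hy⟩ := hq
    simp only [Finset.coe_sigma, Set.mem_sigma_iff, Finset.mem_coe]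
    refine ⟨hA m hm x hx y hy, Finset.mem_univ _, ?_⟩
    rw [Finset.mem_filter]
    exact ⟨Finset.mem_univ _, fst_mem_closedNbhd_switching (hB hm) hx (hY m hm x hx hy)⟩
  · rintro ⟨m, x, y⟩ hq ⟨m', x', y'⟩ hq' heq
    simp only [Finset.coe_sigma, Set.mem_sigma_iff, Finset.mem_coe] at hq hq'
    obtain ⟨hm, hx, hy⟩ := hq
    obtain ⟨hm', hx', hy'⟩ := hq'
    simp only [Sigma.mk.injEq, heq_eq_eq] at heq
    obtain ⟨e1, e2, e3⟩ := heq
    subst e2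
    have s := (switching_apply (hB hm) (hY m hm x hx hy)).1
    have s' := (switching_apply (hB hm') (hY m' hm' x hx' hy')).1
    have hyy : y = y' := by rw [← s, ← s', e1]
    subst hyy
    unfold switching at e1
    rw [e3] at e1
    have : m = m' := mul_left_cancel (mul_right_cancel e1)
    subst this
    rfl

lemma card_badPoints_succ_le {k : ℕ} (hk : k < 80) (hV : 80 ≤ Fintype.card V) :
    ((matchingsOn (Finset.univ : Finset (V × Fin 4))).filter
      (fun m => (badPoints m).card ≤ k + 1)).card ≤
    41 * ((matchingsOn (Finset.univ : Finset (V × Fin 4))).filter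
      (fun m => (badPoints m).card ≤ k)).card := by
  set A := (matchingsOn (Finset.univ : Finset (V × Fin 4))).filter
      (fun m => (badPoints m).card ≤ k) with hA
  set B := (matchingsOn (Finset.univ : Finset (V × Fin 4))).filter
      (fun m => (badPoints m).card = k + 1) with hB
  have hsplit : (matchingsOn (Finset.univ : Finset (V × Fin 4))).filter
      (fun m => (badPoints m).card ≤ k + 1) ⊆ A ∪ B := by
    intro m
    simp only [hA, hB, Finset.mem_union, Finset.mem_filter]
    rintro ⟨h1, h2⟩
    rcases Nat.lt_or_eq_of_le h2 with h | h
    · exact Or.inl ⟨h1, by omega⟩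
    · exact Or.inr ⟨h1, h⟩
  have h1 := (Finset.card_le_card hsplit).trans (Finset.card_union_le _ _)
  have h2 := sum_card_switchings_le A B (Finset.filter_subset _ _)
    (fun m x => farPoints m x \ badPoints m) (fun m _ x _ => Finset.sdiff_subset) (by
      intro m hm x hx y hy
      rw [Finset.mem_sdiff] at hy
      rw [hB, Finset.mem_filter] at hm
      rw [hA, Finset.mem_filter]
      refine ⟨switching_mem hm.1 x y, ?_⟩
      have := Finset.card_lt_card (badPoints_switching_ssubset hm.1 hx hy.1 hy.2)
      omega)
  have h3 : B.card * (2 * Fintype.card V) ≤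
      ∑ m ∈ B, ∑ x ∈ badPoints m, (farPoints m x \ badPoints m).card := by
    rw [← smul_eq_mul]
    refine Finset.card_nsmul_le_sum _ _ _ fun m hm => ?_
    rw [hB, Finset.mem_filter] at hm
    obtain ⟨x, hx⟩ : (badPoints m).Nonempty := by rw [← Finset.card_pos]; omega
    refine le_trans ?_ (Finset.single_le_sum
      (f := fun x => (farPoints m x \ badPoints m).card) (fun _ _ => Nat.zero_le _) hx)
    have e1 := card_le_card_farPoints m x
    have e2 := Finset.le_card_sdiff (badPoints m) (farPoints m x)
    -- At least `4 |V| - 80` points are far and at most `80` of them are bad, which leaves `2 |V|`.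
    omega
  have h4 : B.card ≤ 40 * A.card := by
    have : B.card * (2 * Fintype.card V) ≤ (40 * A.card) * (2 * Fintype.card V) := by
      refine (h3.trans h2).trans (le_of_eq ?_)
      ring
    exact Nat.le_of_mul_le_mul_right this (by omega)
  omega

/-- A positive fraction of all matchings of the points has no loops and no multiple edges. -/
lemma card_matchingsOn_le_simple (hV : 80 ≤ Fintype.card V) :
    (matchingsOn (Finset.univ : Finset (V × Fin 4))).card ≤
      2 * 41 ^ 80 * ((matchingsOn (Finset.univ : Finset (V × Fin 4))).filter
        (fun m => badPoints m = ∅)).card := by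
  set Q : ℕ → ℕ := fun k => ((matchingsOn (Finset.univ : Finset (V × Fin 4))).filter
      (fun m => (badPoints m).card ≤ k)).card with hQ
  have h0 : ((matchingsOn (Finset.univ : Finset (V × Fin 4))).filter
        (fun m => badPoints m = ∅)).card = Q 0 := by
    simp [hQ]
  have h1 : ∀ k ≤ 80, Q k ≤ 41 ^ k * Q 0 := by
    intro k
    induction k with
    | zero => simp
    | succ k ih =>
      intro hk
      calc Q (k + 1) ≤ 41 * Q k := card_badPoints_succ_le (by omega) hV
        _ ≤ 41 * (41 ^ k * Q 0) := Nat.mul_le_mul_left _ (ih (by omega))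
        _ = 41 ^ (k + 1) * Q 0 := by ring
  set M := matchingsOn (Finset.univ : Finset (V × Fin 4)) with hM
  have h2 := sum_card_switchings_le M M (le_refl _) (fun m x => farPoints m x)
    (fun m _ x _ => le_refl _) (fun m hm x _ y _ => switching_mem hm x y)
  have h3 : (∑ m ∈ M, (badPoints m).card) * (3 * Fintype.card V) ≤
      ∑ m ∈ M, ∑ x ∈ badPoints m, (farPoints m x).card := by
    rw [Finset.sum_mul]
    refine Finset.sum_le_sum fun m _ => ?_
    rw [← smul_eq_mul]
    refine Finset.card_nsmul_le_sum _ _ _ fun x _ => ?_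
    have := card_le_card_farPoints m x
    omega
  -- The mean number of bad points is at most `80 / 3`, so by Markov's inequality at most a third of
  -- the matchings have more than `80`.
  have h4 : ∑ m ∈ M, (badPoints m).card ≤ 27 * M.card := by
    have : (∑ m ∈ M, (badPoints m).card) * (3 * Fintype.card V) ≤
        (27 * M.card) * (3 * Fintype.card V) := by
      refine (h3.trans h2).trans ?_
      nlinarith [Nat.zero_le (M.card * Fintype.card V)]
    exact Nat.le_of_mul_le_mul_right this (by omega)
  have h5 : (M.filter (fun m => ¬ (badPoints m).card ≤ 80)).card * 81 ≤
      ∑ m ∈ M, (badPoints m).card := by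
    rw [← smul_eq_mul]
    refine (Finset.card_nsmul_le_sum _ (fun m => (badPoints m).card) _ fun m hm => ?_).trans
      (Finset.sum_le_sum_of_subset (Finset.filter_subset _ _))
    have := (Finset.mem_filter.1 hm).2
    omega
  have h6 := Finset.card_filter_add_card_filter_not (s := M) (fun m => (badPoints m).card ≤ 80)
  have h7 : M.card ≤ 2 * Q 80 := by
    simp only [hQ]
    omega
  rw [h0]
  calc M.card ≤ 2 * Q 80 := h7
    _ ≤ 2 * (41 ^ 80 * Q 0) := Nat.mul_le_mul_left _ (h1 80 le_rfl)
    _ = 2 * 41 ^ 80 * Q 0 := by rw [mul_assoc]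

end Switching

/-! ### Membership in the coloring process -/

section Coloring

open Classical

variable {V : Type*} [Fintype V]

lemma mem_coloringProcess_succ {G : SimpleGraph V} {ψ : V → ℕ} {S : Finset V} {i : ℕ} {v : V}
    (h : v ∈ coloringProcess G ψ S (i + 1)) : v ∈ coloringProcess G ψ S i ∨
      ∃ T : Finset V, ψ v ≤ T.card ∧ ∀ w ∈ T, G.Adj v w ∧ w ∈ coloringProcess G ψ S i := by
  rw [coloringProcess, Finset.mem_union, Finset.mem_filter] at h
  rcases h with h | ⟨-, -, h⟩
  · exact Or.inl h
  · exact Or.inr ⟨_, h, fun w hw => (Finset.mem_filter.1 hw).2⟩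

lemma mem_turnedBlack {G : SimpleGraph V} {ψ : V → ℕ} {S : Finset V} {v : V} :
    v ∈ turnedBlack G ψ S ↔ ∃ i, v ∈ coloringProcess G ψ S i := by
  simp [turnedBlack]

end Coloring

/-! ### From matchings to 4-regular graphs -/

section PointGraph

variable {V : Type*} [Fintype V] [DecidableEq V]

/-- The graph of the edges between vertices that have matched points. -/
def pointGraph (m : Equiv.Perm (V × Fin 4)) : SimpleGraph V :=
  SimpleGraph.fromRel (fun u v => ∃ i, (m (u, i)).1 = v)

/-- The matchings of the points without loops and multiple edges. -/
def simpleMatchings (V : Type*) [Fintype V] [DecidableEq V] : Finset (Equiv.Perm (V × Fin 4)) :=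
  (matchingsOn Finset.univ).filter (fun m => badPoints m = ∅)

lemma pointGraph_adj {m : Equiv.Perm (V × Fin 4)} (hm : m ∈ matchingsOn Finset.univ) {u v : V} :
    (pointGraph m).Adj u v ↔ u ≠ v ∧ ∃ i, (m (u, i)).1 = v := by
  rw [pointGraph, SimpleGraph.fromRel_adj]
  constructor
  · rintro ⟨h, h1 | ⟨i, h1⟩⟩
    · exact ⟨h, h1⟩
    · refine ⟨h, (m (v, i)).2, ?_⟩
      have : (u, (m (v, i)).2) = m (v, i) := Prod.ext h1.symm rfl
      rw [this, (mem_matchingsOn.1 hm).1]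
  · rintro ⟨h, h1⟩
    exact ⟨h, Or.inl h1⟩

lemma mem_simpleMatchings {m : Equiv.Perm (V × Fin 4)} : m ∈ simpleMatchings V ↔
    m ∈ matchingsOn Finset.univ ∧ ∀ x, (m x).1 ≠ x.1 ∧
      ∀ x', x'.1 = x.1 → (m x').1 = (m x).1 → x' = x := by
  rw [simpleMatchings, Finset.mem_filter, Finset.eq_empty_iff_forall_notMem]
  refine and_congr_right fun _ => forall_congr' fun x => ?_
  rw [mem_badPoints, not_or, not_exists]
  refine and_congr_right fun _ => forall_congr' fun x' => ?_
  tauto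

lemma exists_labelling {m : Equiv.Perm (V × Fin 4)} (hm : m ∈ simpleMatchings V) :
    ∃ c : ∀ v, Fin 4 ≃ (pointGraph m).neighborSet v, ∀ v i, (c v i : V) = (m (v, i)).1 := by
  obtain ⟨h0, h1⟩ := mem_simpleMatchings.1 hm
  have hadj : ∀ v i, (m (v, i)).1 ∈ (pointGraph m).neighborSet v := fun v i =>
    (pointGraph_adj h0).2 ⟨fun e => (h1 (v, i)).1 e.symm, i, rfl⟩
  have hbij : ∀ v, Function.Bijective
      (fun i : Fin 4 => (⟨(m (v, i)).1, hadj v i⟩ : (pointGraph m).neighborSet v)) := by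
    intro v
    constructor
    · intro i j hij
      have h2 := (h1 (v, j)).2 (v, i) rfl (congrArg Subtype.val hij)
      exact congrArg Prod.snd h2
    · rintro ⟨w, hw⟩
      obtain ⟨-, i, hi⟩ := (pointGraph_adj h0).1 hw
      exact ⟨i, Subtype.ext hi⟩
  exact ⟨fun v => Equiv.ofBijective _ (hbij v), fun v i => rfl⟩

/-- The point matched to a point, when the points of every vertex are labelled by its
neighbours. -/
def labelPartner {G : SimpleGraph V} (c : ∀ v, Fin 4 ≃ G.neighborSet v) (x : V × Fin 4) :
    V × Fin 4 :=
  ((c x.1 x.2 : V), (c (c x.1 x.2 : V)).symm ⟨x.1, (c x.1 x.2).2.symm⟩)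

omit [Fintype V] [DecidableEq V] in
lemma labelPartner_eq_iff {G : SimpleGraph V} (c : ∀ v, Fin 4 ≃ G.neighborSet v)
    {x z : V × Fin 4} :
    labelPartner c x = z ↔ (c x.1 x.2 : V) = z.1 ∧ (c z.1 z.2 : V) = x.1 := by
  constructor
  · rintro rfl
    refine ⟨rfl, ?_⟩
    change ((c (c x.1 x.2 : V)) ((c (c x.1 x.2 : V)).symm ⟨x.1, (c x.1 x.2).2.symm⟩) : V) = x.1
    rw [Equiv.apply_symm_apply]
  · obtain ⟨w, j⟩ := z
    rintro ⟨h1, h2⟩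
    simp only at h1 h2
    subst h1
    refine Prod.ext rfl ?_
    simp only [labelPartner]
    rw [Equiv.symm_apply_eq]
    exact Subtype.ext h2.symm

omit [Fintype V] [DecidableEq V] in
lemma labelPartner_involutive {G : SimpleGraph V} (c : ∀ v, Fin 4 ≃ G.neighborSet v) :
    Function.Involutive (labelPartner c) := fun x =>
  (labelPartner_eq_iff c).2 (((labelPartner_eq_iff c).1 (rfl : labelPartner c x = _)).symm)

-- A simple matching with graph `G` amounts to a labelling of the four neighbours of each vertex by
-- its four points, which can be chosen in `4! = 24` ways per vertex.
open Classical in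
lemma card_fiber_pointGraph {G : SimpleGraph V} (hG : G.IsRegularOfDegree 4) :
    ((simpleMatchings V).filter (fun m => pointGraph m = G)).card = 24 ^ Fintype.card V := by
  have hcard : ∀ v, Fintype.card (G.neighborSet v) = 4 := by
    intro v
    rw [G.card_neighborSet_eq_degree]
    exact hG v
  have h24 : Fintype.card (∀ v, Fin 4 ≃ G.neighborSet v) = 24 ^ Fintype.card V := by
    rw [Fintype.card_pi]
    have : ∀ v, Fintype.card (Fin 4 ≃ G.neighborSet v) = 24 := by
      intro v
      have e : Fin 4 ≃ G.neighborSet v := Fintype.equivOfCardEq (by rw [hcard, Fintype.card_fin])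
      rw [Fintype.card_equiv e, Fintype.card_fin]
      rfl
    simp [this]
  rw [← h24, ← Finset.card_univ]
  symm
  have hmem : ∀ c : ∀ v, Fin 4 ≃ G.neighborSet v,
      (labelPartner_involutive c).toPerm ∈ matchingsOn Finset.univ := by
    intro c
    refine mem_matchingsOn.2 ⟨fun x => labelPartner_involutive c x, fun x => ?_⟩
    simp only [Finset.mem_univ, iff_true]
    intro h
    have h1 := ((labelPartner_eq_iff c).1 h).1
    have h2 : G.Adj x.1 (c x.1 x.2) := (c x.1 x.2).2
    rw [h1] at h2
    exact G.irrefl h2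
  refine Finset.card_bij (fun c _ => (labelPartner_involutive c).toPerm) ?_ ?_ ?_
  · intro c _
    rw [Finset.mem_filter, mem_simpleMatchings]
    refine ⟨⟨hmem c, fun x => ⟨?_, fun x' e1 e2 => ?_⟩⟩, ?_⟩
    · intro h
      have h2 : G.Adj x.1 (c x.1 x.2) := (c x.1 x.2).2
      have h3 : (c x.1 x.2 : V) = x.1 := h
      rw [h3] at h2
      exact G.irrefl h2
    · obtain ⟨v, i⟩ := x
      obtain ⟨v', i'⟩ := x'
      simp only at e1
      subst e1
      have : c v' i' = c v' i := Subtype.ext e2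
      rw [(c v').injective this]
    · ext u v
      rw [pointGraph_adj (hmem c)]
      constructor
      · rintro ⟨-, i, hi⟩
        have h2 : G.Adj u (c u i) := (c u i).2
        have h3 : (c u i : V) = v := hi
        rwa [h3] at h2
      · intro h
        refine ⟨h.ne, (c u).symm ⟨v, h⟩, ?_⟩
        change (c u ((c u).symm ⟨v, h⟩) : V) = v
        simp
  · intro c _ c' _ h
    funext v
    ext i
    exact congrArg Prod.fst (Equiv.congr_fun h (v, i))
  · intro m hm
    obtain ⟨hm, hmG⟩ := Finset.mem_filter.1 hm
    obtain ⟨c, hc⟩ : ∃ c : ∀ v, Fin 4 ≃ G.neighborSet v, ∀ v i, (c v i : V) = (m (v, i)).1 :=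
      hmG ▸ exists_labelling hm
    refine ⟨c, Finset.mem_univ _, ?_⟩
    ext1 x
    change labelPartner c x = m x
    rw [labelPartner_eq_iff]
    refine ⟨hc _ _, ?_⟩
    rw [hc, Prod.mk.eta, (mem_matchingsOn.1 (mem_simpleMatchings.1 hm).1).1 x]

open Classical in
lemma pointGraph_mem_regularGraphs {n : ℕ} {m : Equiv.Perm (Fin n × Fin 4)}
    (hm : m ∈ simpleMatchings (Fin n)) : pointGraph m ∈ regularGraphs n 4 := by
  rw [regularGraphs, Finset.mem_filter]
  refine ⟨Finset.mem_univ _, fun v => ?_⟩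
  obtain ⟨c, -⟩ := exists_labelling hm
  rw [← SimpleGraph.card_neighborSet_eq_degree, ← Fintype.card_congr (c v), Fintype.card_fin]

open Classical in
lemma card_filter_regularGraphs (n : ℕ) (P : SimpleGraph (Fin n) → Prop) [DecidablePred P] :
    ((simpleMatchings (Fin n)).filter (fun m => P (pointGraph m))).card =
      ((regularGraphs n 4).filter P).card * 24 ^ n := by
  rw [Finset.card_eq_sum_card_fiberwise (f := pointGraph) (t := (regularGraphs n 4).filter P)]
  · rw [← smul_eq_mul, ← Finset.sum_const]
    refine Finset.sum_congr rfl fun G hG => ?_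
    obtain ⟨hG, hP⟩ := Finset.mem_filter.1 hG
    rw [regularGraphs, Finset.mem_filter] at hG
    have h := card_fiber_pointGraph hG.2
    rw [Fintype.card_fin] at h
    rw [← h, Finset.filter_filter]
    congr 1
    ext m
    simp only [Finset.mem_filter]
    constructor
    · rintro ⟨h1, -, h2⟩; exact ⟨h1, h2⟩
    · rintro ⟨h1, h2⟩; exact ⟨h1, h2 ▸ hP, h2⟩
  · intro m hm
    obtain ⟨h1, h2⟩ := Finset.mem_filter.1 (Finset.mem_coe.1 hm)
    exact Finset.mem_coe.2 (Finset.mem_filter.2 ⟨pointGraph_mem_regularGraphs h1, h2⟩)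

/-- By induction on time the core stays white: black neighbours of a core vertex lie outside the
core, and there is at most one. -/
lemma card_turnedBlack_le_of_hasWhiteCore {t : ℕ} {S : Finset V} {m : Equiv.Perm (V × Fin 4)}
    (hm : m ∈ matchingsOn Finset.univ) (h : HasWhiteCore t S Finset.univ m) :
    t + 4 * (turnedBlack (pointGraph m) simpleMajority S).card ≤ 4 * Fintype.card V := by
  obtain ⟨U, hU, ht, hc⟩ := h
  have key : ∀ i, ∀ v ∈ U, v ∉ coloringProcess (pointGraph m) simpleMajority S i := by
    intro i
    induction i with
    | zero =>
      intro v hv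
      exact Finset.disjoint_left.1 hU hv
    | succ i ih =>
      intro v hv hmem
      rcases mem_coloringProcess_succ hmem with hmem | ⟨T, h2, hT⟩
      · exact ih v hv hmem
      · have hv1 := hc v hv
        have hle : T ⊆
            (Finset.univ.filter (fun i : Fin 4 => (v, i) ∉ (Finset.univ : Finset (V × Fin 4)) ∨
              (m (v, i)).1 ∉ U)).image (fun i => (m (v, i)).1) := by
          intro w hw
          obtain ⟨hadj, hwS⟩ := hT w hw
          obtain ⟨-, k, hk⟩ := (pointGraph_adj hm).1 hadj
          refine Finset.mem_image.2 ⟨k, ?_, hk⟩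
          refine Finset.mem_filter.2 ⟨Finset.mem_univ _, Or.inr fun hkU => ?_⟩
          rw [hk] at hkU
          exact ih w hkU hwS
        have h3 := (Finset.card_le_card hle).trans Finset.card_image_le
        have h4 : 2 ≤ T.card := h2
        have := h4.trans (h3.trans hv1)
        omega
  have hdisj : Disjoint U (turnedBlack (pointGraph m) simpleMajority S) := by
    rw [Finset.disjoint_left]
    intro v hv hb
    obtain ⟨i, hi⟩ := mem_turnedBlack.1 hb
    exact key i v hv hi
  have := Finset.card_le_univ (U ∪ turnedBlack (pointGraph m) simpleMajority S)
  rw [Finset.card_union_of_disjoint hdisj] at this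
  omega

end PointGraph

/-! ### The binomial number of seeds -/

section Seeds

variable {V : Type*} [Fintype V]

lemma seedProb_eq (p : ℝ) (S : Finset V) :
    seedProb p S = p ^ S.card * (1 - p) ^ (Fintype.card V - S.card) := by
  classical
  unfold seedProb
  rw [Finset.prod_ite, Finset.prod_const, Finset.prod_const]
  congr 2
  · congr 1; ext v; simp
  · rw [← Finset.card_compl]; congr 1; ext v; simp

lemma seedProb_nonneg {p : ℝ} (h0 : 0 ≤ p) (h1 : p ≤ 1) (S : Finset V) : 0 ≤ seedProb p S := by
  rw [seedProb_eq]
  exact mul_nonneg (pow_nonneg h0 _) (pow_nonneg (by linarith) _)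

/-- Turns mean and variance of the number of seeds into the known identities for Bernstein
polynomials. -/
lemma sum_seedProb_mul (p : ℝ) (g : ℕ → ℝ) :
    ∑ S : Finset V, g S.card * seedProb p S = ∑ k ∈ Finset.range (Fintype.card V + 1),
      g k * (bernsteinPolynomial ℝ (Fintype.card V) k).eval p := by
  have h := Finset.sum_powerset_apply_card
    (fun k => g k * (p ^ k * (1 - p) ^ (Fintype.card V - k))) (x := (Finset.univ : Finset V))
  rw [Finset.powerset_univ, Finset.card_univ] at h
  simp only [seedProb_eq]
  rw [h]
  refine Finset.sum_congr rfl fun k _ => ?_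
  simp [bernsteinPolynomial, nsmul_eq_mul]
  ring

lemma sum_seedProb (p : ℝ) : ∑ S : Finset V, seedProb p S = 1 := by
  have h := sum_seedProb_mul (V := V) p (fun _ => 1)
  simp only [one_mul] at h
  rw [h, ← Polynomial.eval_finsetSum, bernsteinPolynomial.sum, Polynomial.eval_one]

lemma sum_sq_mul_seedProb (p : ℝ) :
    ∑ S : Finset V, ((Fintype.card V : ℝ) * p - S.card) ^ 2 * seedProb p S =
      Fintype.card V * p * (1 - p) := by
  rw [sum_seedProb_mul (V := V) p (fun k => ((Fintype.card V : ℝ) * p - k) ^ 2)]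
  have h := congrArg (Polynomial.eval p) (bernsteinPolynomial.variance ℝ (Fintype.card V))
  rw [Polynomial.eval_finsetSum] at h
  simpa [nsmul_eq_mul] using h

end Seeds

/-! ### Assembling the bounds -/

lemma totalWeight_univ {V : Type*} [Fintype V] [DecidableEq V] (β γ : ℝ) (S : Finset V) :
    totalWeight β γ S Finset.univ =
      ((Fintype.card V : ℝ) - S.card) * (12 * γ - 8 * β) := by
  have h : ∀ v, vertexWeight β γ (freeDegree (Finset.univ : Finset (V × Fin 4)) v) =
      12 * γ - 8 * β := by
    intro v
    simp [vertexWeight, freeDegree]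
  unfold totalWeight
  simp only [h]
  rw [Finset.sum_const, nsmul_eq_mul]
  have h2 : Finset.univ.filter (fun v => v ∉ S) = Sᶜ := by ext v; simp
  rw [h2, Finset.card_compl, Nat.cast_sub (Finset.card_le_univ S)]

open Classical in
/-- For every set of at most `0.1015 n` seeds, all but a fraction `O(1 / n)` of the `4`-regular
graphs turn at most `0.36 n` vertices black. -/
lemma card_regularGraphs_many_black_le {n : ℕ} (hn : 4000 ≤ n) {S : Finset (Fin n)}
    (hS : (S.card : ℝ) ≤ 0.1015 * n) :
    (((regularGraphs n 4).filter (fun G =>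
      ¬ ((turnedBlack G simpleMajority S).card : ℝ) ≤ 0.36 * n)).card : ℝ) ≤
      (regularGraphs n 4).card * (2 * 41 ^ 80 * 3240000 / n) := by
  have hn' : (4000 : ℝ) ≤ n := by exact_mod_cast hn
  -- Exposing `j = ⌊0.72 n⌋` edges leaves `t` free points with `2.56 n ≤ t < 2.56 n + 2`.
  obtain ⟨j, hj1, hj2⟩ : ∃ j : ℕ, 100 * j ≤ 72 * n ∧ 72 * n < 100 * j + 100 :=
    ⟨72 * n / 100, by omega, by omega⟩
  obtain ⟨r, hr⟩ : ∃ r : ℕ, r + j = 2 * n := ⟨2 * n - j, by omega⟩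
  set t := 2 * r with ht
  have htj : t + 2 * j = 4 * n := by omega
  have hj1' : 100 * (j : ℝ) ≤ 72 * n := by exact_mod_cast hj1
  have hj2' : 72 * (n : ℝ) < 100 * j + 100 := by exact_mod_cast hj2
  have htj' : (t : ℝ) + 2 * j = 4 * n := by exact_mod_cast htj
  have hw := le_initial_weight hn htj (by linarith) (by linarith)
  set W := 12 * discount 3 t j - 8 * discount 4 t j
  have hcardV : Fintype.card (Fin n) = n := Fintype.card_fin n
  have hcard : (Finset.univ : Finset (Fin n × Fin 4)).card = t + 2 * j := by
    rw [Finset.card_univ, Fintype.card_prod, Fintype.card_fin, Fintype.card_fin]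
    omega
  -- Here `c` is the initial weight itself, so only the variance term `81 j` remains. The margin `n
  -- / 200` fits because `0.8985 * 2.859 > 2.568`.
  have hcore := card_not_hasWhiteCore_le ht (by omega) S
    (c := ((n : ℝ) - S.card) * W) (δ := n / 200) (by positivity)
    (by nlinarith) j Finset.univ hcard
  rw [totalWeight_univ, hcardV, sub_self,
    ← card_matchingsOn (r + j) (Finset.univ : Finset (Fin n × Fin 4)) (by omega)] at hcore
  have hsimple := card_matchingsOn_le_simple (V := Fin n) (by omega)
  have hreg := card_filter_regularGraphs n (fun _ => True)
  simp only [Finset.filter_true] at hreg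
  have hbad := card_filter_regularGraphs n
    (fun G => ¬ ((turnedBlack G simpleMajority S).card : ℝ) ≤ 0.36 * n)
  have hsub : ((simpleMatchings (Fin n)).filter (fun m =>
      ¬ ((turnedBlack (pointGraph m) simpleMajority S).card : ℝ) ≤ 0.36 * n)) ⊆
      (matchingsOn Finset.univ).filter (fun m => ¬ HasWhiteCore t S Finset.univ m) := by
    intro m hm
    obtain ⟨h1, h2⟩ := Finset.mem_filter.1 hm
    have h0 := (mem_simpleMatchings.1 h1).1
    refine Finset.mem_filter.2 ⟨h0, fun h => h2 ?_⟩
    have h3 := card_turnedBlack_le_of_hasWhiteCore h0 h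
    rw [hcardV] at h3
    have h3' : (t : ℝ) + 4 * ((turnedBlack (pointGraph m) simpleMajority S).card : ℝ) ≤ 4 * n := by
      exact_mod_cast h3
    linarith
  have hle := Finset.card_le_card hsub
  rw [hbad] at hle
  change (matchingsOn (Finset.univ : Finset (Fin n × Fin 4))).card ≤
    2 * 41 ^ 80 * (simpleMatchings (Fin n)).card at hsimple
  rw [hreg] at hsimple
  have hle' : (((regularGraphs n 4).filter (fun G =>
      ¬ ((turnedBlack G simpleMajority S).card : ℝ) ≤ 0.36 * n)).card : ℝ) * 24 ^ n ≤
      (((matchingsOn Finset.univ).filter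
        (fun m => ¬ HasWhiteCore t S Finset.univ m)).card : ℝ) := by exact_mod_cast hle
  have hsimple' : ((matchingsOn (Finset.univ : Finset (Fin n × Fin 4))).card : ℝ) ≤
      2 * 41 ^ 80 * ((regularGraphs n 4).card * 24 ^ n) := by exact_mod_cast hsimple
  have hfrac : ((0 : ℝ) ^ 2 + 81 * j) / (n / 200 : ℝ) ^ 2 ≤ 3240000 / n := by
    rw [div_le_div_iff₀ (by positivity) (by positivity)]
    nlinarith
  have h24 : (0 : ℝ) < 24 ^ n := by positivity
  refine le_of_mul_le_mul_right ?_ h24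
  calc _ ≤ _ := hle'
    _ ≤ _ := hcore
    _ ≤ (2 * 41 ^ 80 * ((regularGraphs n 4).card * 24 ^ n)) * (3240000 / n) :=
        mul_le_mul hsimple' hfrac (by positivity) (by positivity)
    _ = _ := by ring

lemma regularGraphs_card_pos {n : ℕ} (hn : 80 ≤ n) : 0 < (regularGraphs n 4).card := by
  have hsimple := card_matchingsOn_le_simple (V := Fin n) (by rw [Fintype.card_fin]; omega)
  change (matchingsOn (Finset.univ : Finset (Fin n × Fin 4))).card ≤
    2 * 41 ^ 80 * (simpleMatchings (Fin n)).card at hsimple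
  have hreg := card_filter_regularGraphs n (fun _ => True)
  simp only [Finset.filter_true] at hreg
  rw [hreg, card_matchingsOn (2 * n) _ (by
    rw [Finset.card_univ, Fintype.card_prod, Fintype.card_fin, Fintype.card_fin]; omega)] at hsimple
  rw [Nat.pos_iff_ne_zero]
  intro h
  rw [h, zero_mul, mul_zero, Nat.le_zero, Finset.prod_eq_zero_iff] at hsimple
  obtain ⟨i, -, hi⟩ := hsimple
  omega

open Classical in
lemma prob_add_prob_of_iff_not {n d : ℕ} (p : ℝ)
    {E F : SimpleGraph (Fin n) → Finset (Fin n) → Prop} (hF : ∀ G S, F G S ↔ ¬ E G S)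
    (h : 0 < (regularGraphs n d).card) : prob n d p E + prob n d p F = 1 := by
  have h' : ((regularGraphs n d).card : ℝ) ≠ 0 := by positivity
  unfold prob
  rw [← add_div, div_eq_one_iff_eq h', ← Finset.sum_add_distrib]
  have : ∀ G ∈ regularGraphs n d, (∑ S : Finset (Fin n), if E G S then seedProb p S else 0) +
      (∑ S : Finset (Fin n), if F G S then seedProb p S else 0) = 1 := by
    intro G _
    rw [← Finset.sum_add_distrib, ← sum_seedProb (V := Fin n) p]
    refine Finset.sum_congr rfl fun S _ => ?_
    have hFS := hF G S
    by_cases hE : E G S <;> simp [hE, hFS]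
  refine (Finset.sum_congr rfl this).trans ?_
  simp

lemma prob_nonneg {n d : ℕ} {p : ℝ} (h0 : 0 ≤ p) (h1 : p ≤ 1)
    (E : SimpleGraph (Fin n) → Finset (Fin n) → Prop) : 0 ≤ prob n d p E := by
  unfold prob
  refine div_nonneg (Finset.sum_nonneg fun G _ => Finset.sum_nonneg fun S _ => ?_) (by positivity)
  split_ifs
  · exact seedProb_nonneg h0 h1 S
  · exact le_rfl

open Classical in
lemma prob_many_black_le {n : ℕ} (hn : 4000 ≤ n) {p : ℝ} (h0 : 0 ≤ p) (h1 : p ≤ 0.10)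
    {F : SimpleGraph (Fin n) → Finset (Fin n) → Prop}
    (hF : ∀ G S, ((turnedBlack G simpleMajority S).card : ℝ) ≤ 0.36 * n → ¬ F G S) :
    prob n 4 p F ≤ (2 * 41 ^ 80 * 3240000 + 1000000) / n := by
  have hn' : (4000 : ℝ) ≤ n := by exact_mod_cast hn
  have hR : (0 : ℝ) < (regularGraphs n 4).card := by
    exact_mod_cast regularGraphs_card_pos (by omega)
  set R : ℝ := ((regularGraphs n 4).card : ℝ) with hRdef
  set K : ℝ := 2 * 41 ^ 80 * 3240000 with hK
  have hK0 : 0 ≤ K := by positivity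
  have hseed : ∀ S : Finset (Fin n),
      (((regularGraphs n 4).filter (fun G => F G S)).card : ℝ) ≤
        R * (K / n + ((n : ℝ) * p - S.card) ^ 2 / (0.0015 * n) ^ 2) := by
    intro S
    by_cases hS : (S.card : ℝ) ≤ 0.1015 * n
    · calc (((regularGraphs n 4).filter (fun G => F G S)).card : ℝ) ≤
            (((regularGraphs n 4).filter (fun G =>
              ¬ ((turnedBlack G simpleMajority S).card : ℝ) ≤ 0.36 * n)).card : ℝ) := by
            refine Nat.cast_le.2 (Finset.card_le_card fun G hG => ?_)
            obtain ⟨h1, h2⟩ := Finset.mem_filter.1 hG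
            exact Finset.mem_filter.2 ⟨h1, fun h => hF G S h h2⟩
        _ ≤ R * (K / n) := card_regularGraphs_many_black_le hn hS
        _ ≤ _ := by
            refine mul_le_mul_of_nonneg_left ?_ hR.le
            have : 0 ≤ ((n : ℝ) * p - S.card) ^ 2 / (0.0015 * (n : ℝ)) ^ 2 := by positivity
            linarith
    -- Seed sets with more than `0.1015 n` elements deviate from the mean by at least `0.0015 n`;
    -- they are paid for by the variance.
    · have h2 : 1 ≤ ((n : ℝ) * p - S.card) ^ 2 / (0.0015 * (n : ℝ)) ^ 2 := by
        rw [one_le_div (by positivity)]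
        have h3 : (n : ℝ) * p ≤ n * 0.10 := mul_le_mul_of_nonneg_left h1 (by positivity)
        nlinarith
      have h3 : 0 ≤ K / n := by positivity
      calc (((regularGraphs n 4).filter (fun G => F G S)).card : ℝ) ≤ R := by
            rw [hRdef]
            exact_mod_cast Finset.card_filter_le _ _
        _ ≤ _ := le_mul_of_one_le_right hR.le (by linarith)
  unfold prob
  rw [div_le_iff₀ hR, Finset.sum_comm]
  have hvar := sum_sq_mul_seedProb (V := Fin n) p
  rw [Fintype.card_fin] at hvar
  calc ∑ S : Finset (Fin n), ∑ G ∈ regularGraphs n 4, (if F G S then seedProb p S else 0)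
      = ∑ S : Finset (Fin n),
        (((regularGraphs n 4).filter (fun G => F G S)).card : ℝ) * seedProb p S := by
        refine Finset.sum_congr rfl fun S _ => ?_
        rw [← Finset.sum_filter, Finset.sum_const, nsmul_eq_mul]
    _ ≤ ∑ S : Finset (Fin n), R * (K / n + ((n : ℝ) * p - S.card) ^ 2 / (0.0015 * n) ^ 2) *
          seedProb p S := Finset.sum_le_sum fun S _ =>
        mul_le_mul_of_nonneg_right (hseed S) (seedProb_nonneg h0 (by linarith) S)
    _ = R * (K / n * ∑ S : Finset (Fin n), seedProb p S + (∑ S : Finset (Fin n),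
          ((n : ℝ) * p - S.card) ^ 2 * seedProb p S) / (0.0015 * n) ^ 2) := by
        rw [Finset.mul_sum, Finset.sum_div, ← Finset.sum_add_distrib, Finset.mul_sum]
        refine Finset.sum_congr rfl fun S _ => ?_
        ring
    _ ≤ (K + 1000000) / n * R := by
        rw [sum_seedProb, hvar, mul_comm R]
        refine mul_le_mul_of_nonneg_right ?_ hR.le
        rw [mul_one, add_div]
        refine add_le_add le_rfl ?_
        rw [div_le_div_iff₀ (by positivity) (by positivity)]
        have : p * (1 - p) ≤ 1 := by nlinarith
        nlinarith [mul_le_mul_of_nonneg_left this (by positivity : (0 : ℝ) ≤ (n : ℝ) * n)]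

lemma tendsto_prob_of_few_black {p : ℕ → ℝ} (hp0 : ∀ n, 0 ≤ p n) (hp : ∀ n, p n ≤ 0.10)
    (E : (n : ℕ) → SimpleGraph (Fin n) → Finset (Fin n) → Prop)
    (hE : ∀ n : ℕ, 4000 ≤ n → ∀ G S,
      ((turnedBlack G simpleMajority S).card : ℝ) ≤ 0.36 * n → E n G S) :
    Tendsto (fun n : ℕ => prob n 4 (p n) (E n)) atTop (𝓝 1) := by
  have hlim : Tendsto (fun n : ℕ => 1 - (2 * 41 ^ 80 * 3240000 + 1000000 : ℝ) / n) atTop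
      (𝓝 1) := by
    have := (tendsto_const_div_atTop_nhds_zero_nat (2 * 41 ^ 80 * 3240000 + 1000000 : ℝ)).const_sub 1
    rwa [sub_zero] at this
  refine tendsto_of_tendsto_of_tendsto_of_le_of_le' hlim tendsto_const_nhds ?_ ?_
  · filter_upwards [eventually_ge_atTop 4000] with n hn
    have h1 := prob_add_prob_of_iff_not (p n) (E := E n) (F := fun G S => ¬ E n G S)
      (fun _ _ => Iff.rfl) (regularGraphs_card_pos (n := n) (by omega))
    have h2 := prob_many_black_le hn (hp0 n) (hp n) (F := fun G S => ¬ E n G S)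
      fun G S h => not_not.2 (hE n hn G S h)
    linarith
  · filter_upwards [eventually_ge_atTop 4000] with n hn
    have h1 := prob_add_prob_of_iff_not (p n) (E := E n) (F := fun G S => ¬ E n G S)
      (fun _ _ => Iff.rfl) (regularGraphs_card_pos (n := n) (by omega))
    have h2 := prob_nonneg (d := 4) (hp0 n) (by linarith [hp n]) (fun G S => ¬ E n G S)
    linarith

end Dynamo

theorem theorem4 (p : ℕ → ℝ) (hp0 : ∀ n, 0 ≤ p n) (hp : ∀ n, p n ≤ 0.10) :
    Tendsto
      (fun n : ℕ => Dynamo.prob n 4 (p n)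
        (fun G S => ¬ Dynamo.IsDynamo G Dynamo.simpleMajority S))
      atTop (𝓝 1) ∧
    Tendsto
      (fun n : ℕ => Dynamo.prob n 4 (p n)
        (fun G S => ((Dynamo.turnedBlack G Dynamo.simpleMajority S).card : ℝ) < 0.40 * (n : ℝ)))
      atTop (𝓝 1) := by
  constructor
  · refine Dynamo.tendsto_prob_of_few_black hp0 hp
      (fun n G S => ¬ Dynamo.IsDynamo G Dynamo.simpleMajority S) ?_
    rintro n hn G S h ⟨i, hi⟩
    have hn' : (4000 : ℝ) ≤ n := by exact_mod_cast hn
    have : Dynamo.turnedBlack G Dynamo.simpleMajority S = Finset.univ :=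
      Finset.eq_univ_of_forall fun v => Dynamo.mem_turnedBlack.2 ⟨i, hi ▸ Finset.mem_univ v⟩
    rw [this, Finset.card_univ, Fintype.card_fin] at h
    linarith
  · refine Dynamo.tendsto_prob_of_few_black hp0 hp
      (fun n G S => ((Dynamo.turnedBlack G Dynamo.simpleMajority S).card : ℝ) < 0.40 * (n : ℝ)) ?_
    intro n hn G S h
    have hn' : (4000 : ℝ) ≤ n := by exact_mod_cast hn
    linarith
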